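/- For positive definite matrices \(R,P,Q\in M_d(\mathbb C)\) put \[ F_R(P,Q):=\operatorname{Tr}\!\left[\bigl(R^{1/2}PR^{1/2}\bigr)^{1/2}R^{-1}\bigl(R^{1/2}QR^{1/2}\bigr)^{1/2}\right], \] and for \(x\in\mathbb R\) let \[ F^{\mathrm{pol}}_x(P,Q):=\frac{F_{P^x}(P,Q)+F_{Q^x}(P,Q)}{2}, \] which is a real number, be the symmetrized \(x\)-polar fidelity. A quantum channel is a completely positive, trace-preserving linear map \(M_d(\mathbb C)\to M_e(\mathbb C)\); it has commuting range if any two matrices in its range commute. Proposition. Let \(x\in[-1,1]\), let \(P,Q\in M_d(\mathbb C)\) be positive definite, and let \(\Lambda:M_d(\mathbb C)\to M_e(\mathbb C)\) be a quantum channel such that \(\Lambda(P)\) and \(\Lambda(Q)\) are positive definite. Then \[ F^{\mathrm{pol}}_x(\Lambda(P),\Lambda(Q))\ge F^{\mathrm{pol}}_x(P,Q) \] whenever one of the following conditions is satisfied: (a) \(PQ=QP\); (b) \(\Lambda(P)\Lambda(Q)=\Lambda(Q)\Lambda(P)\); (c) \(\Lambda=\Gamma\circ M\), where, for some \(k\),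 \(M:M_d(\mathbb C)\to M_k(\mathbb C)\) is a quantum channel with commuting range, \(\Gamma:M_k(\mathbb C)\to M_e(\mathbb C)\) is a quantum channel, and \(M(P),M(Q)\) are positive definite. -/

import Mathlib

open scoped MatrixOrder ComplexOrder

namespace PolarFidelity

/-- The generalized fidelity
`F_R(P,Q) = Tr[(R^{1/2} P R^{1/2})^{1/2} R⁻¹ (R^{1/2} Q R^{1/2})^{1/2}]` with base `R`, a complex
number. Real powers of positive matrices are those of the continuous functional calculus. -/
noncomputable def generalizedFidelity {d : ℕ} (R P Q : Matrix (Fin d) (Fin d) ℂ) : ℂ :=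
  ((R ^ (1 / 2 : ℝ) * P * R ^ (1 / 2 : ℝ)) ^ (1 / 2 : ℝ) * R⁻¹ *
    (R ^ (1 / 2 : ℝ) * Q * R ^ (1 / 2 : ℝ)) ^ (1 / 2 : ℝ)).trace

/-- The one-sided polar path `Φ_P(x) = F_{P^x}(P,Q)`. -/
noncomputable def leftPolar {d : ℕ} (x : ℝ) (P Q : Matrix (Fin d) (Fin d) ℂ) : ℂ :=
  generalizedFidelity (P ^ x) P Q

/-- The one-sided polar path `Φ_Q(x) = F_{Q^x}(P,Q)`. -/
noncomputable def rightPolar {d : ℕ} (x : ℝ) (P Q : Matrix (Fin d) (Fin d) ℂ) : ℂ :=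
  generalizedFidelity (Q ^ x) P Q

/-- The symmetrized `x`-polar fidelity `(Φ_P(x) + Φ_Q(x)) / 2` as a real number. Taking the real
part loses nothing on positive definite matrices: see `ofReal_polarFidelity`. -/
noncomputable def polarFidelity {d : ℕ} (x : ℝ) (P Q : Matrix (Fin d) (Fin d) ℂ) : ℝ :=
  ((leftPolar x P Q + rightPolar x P Q) / 2).re

section Real

open Matrix

private lemma base_pow {d : ℕ} (x : ℝ) {P : Matrix (Fin d) (Fin d) ℂ} (hP : P.PosDef) :
    ((P ^ x) ^ (1 / 2 : ℝ) * P * (P ^ x) ^ (1 / 2 : ℝ)) ^ (1 / 2 : ℝ) * (P ^ x)⁻¹ =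
      P ^ ((1 - x) / 2) ∧
    (P ^ x)⁻¹ * ((P ^ x) ^ (1 / 2 : ℝ) * P * (P ^ x) ^ (1 / 2 : ℝ)) ^ (1 / 2 : ℝ) =
      P ^ ((1 - x) / 2) := by
  have h0 : IsStrictlyPositive P := Matrix.isStrictlyPositive_iff_posDef.mpr hP
  have hu : IsUnit P := h0.isUnit
  have hn : (0 : Matrix (Fin d) (Fin d) ℂ) ≤ P := h0.nonneg
  have h1 : ∀ y z : ℝ, (P ^ y) ^ z = P ^ (y * z) := by
    intro y z
    rcases eq_or_ne y 0 with rfl | hy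
    · rw [CFC.rpow_zero P, CFC.one_rpow, zero_mul, CFC.rpow_zero P]
    · exact CFC.rpow_rpow P y z hy h0
  have h2 : (P ^ x)⁻¹ = P ^ (-x) :=
    Matrix.inv_eq_left_inv (CFC.rpow_neg_mul_rpow x h0)
  have h3 : P ^ (x * (1 / 2)) * P * P ^ (x * (1 / 2)) = P ^ (1 + x) := by
    conv_lhs => rw [← CFC.rpow_one P hn]
    rw [h1, ← CFC.rpow_add hu, ← CFC.rpow_add hu]
    congr 1
    ring
  rw [h1 x, h3, h1, h2, ← CFC.rpow_add hu, ← CFC.rpow_add hu]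
  constructor <;> congr 1 <;> ring

private lemma trace_mul_im {d : ℕ} {A B : Matrix (Fin d) (Fin d) ℂ} (hA : 0 ≤ A) (hB : 0 ≤ B) :
    ((A * B).trace).im = 0 := by
  have hA' : Aᴴ = A := (Matrix.nonneg_iff_posSemidef.mp hA).isHermitian
  have hB' : Bᴴ = B := (Matrix.nonneg_iff_posSemidef.mp hB).isHermitian
  have h : star (A * B).trace = (A * B).trace := by
    rw [← Matrix.trace_conjTranspose, Matrix.conjTranspose_mul, hA', hB', Matrix.trace_mul_comm]
  exact Complex.conj_eq_iff_im.mp h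

/-- For positive definite `P` and `Q` the symmetrized polar fidelity is the (real) average of the
two one-sided polar paths. -/
theorem ofReal_polarFidelity {d : ℕ} (x : ℝ) {P Q : Matrix (Fin d) (Fin d) ℂ}
    (hP : P.PosDef) (hQ : Q.PosDef) :
    ((polarFidelity x P Q : ℝ) : ℂ) = (leftPolar x P Q + rightPolar x P Q) / 2 := by
  have hl : (leftPolar x P Q).im = 0 := by
    unfold leftPolar generalizedFidelity
    rw [(base_pow x hP).1]
    exact trace_mul_im CFC.rpow_nonneg CFC.rpow_nonneg
  have hr : (rightPolar x P Q).im = 0 := by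
    unfold rightPolar generalizedFidelity
    rw [mul_assoc, (base_pow x hQ).2]
    exact trace_mul_im CFC.rpow_nonneg CFC.rpow_nonneg
  apply Complex.ext
  · simp [polarFidelity]
  · simp [hl, hr]

end Real

section Channel

open scoped CStarAlgebra Matrix.Norms.L2Operator

/-- A quantum channel: a completely positive, trace-preserving linear map between matrix
algebras. -/
def IsQuantumChannel {d e : ℕ}
    (Λ : Matrix (Fin d) (Fin d) ℂ →ₗ[ℂ] Matrix (Fin e) (Fin e) ℂ) : Prop :=
  (∃ Φ : Matrix (Fin d) (Fin d) ℂ →CP Matrix (Fin e) (Fin e) ℂ, Φ.toLinearMap = Λ) ∧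
    ∀ X, (Λ X).trace = X.trace

end Channel

/-- Any two matrices in the range of `M` commute. -/
def HasCommutingRange {d e : ℕ}
    (M : Matrix (Fin d) (Fin d) ℂ →ₗ[ℂ] Matrix (Fin e) (Fin e) ℂ) : Prop :=
  ∀ X Y, Commute (M X) (M Y)

end PolarFidelity

/-! Write Φ_P(x) = Tr P^{(1-x)/2} (P^{x/2} Q P^{x/2})^{1/2}; the polar fidelity averages Φ_P and
Φ_Q. For commuting arguments both equal Tr P^{1/2} Q^{1/2}, so (a) and (b) become bounds on
one-sided paths, and (c) applies (b) to M, then (a) to Γ.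

In (b), a polar decomposition turns Φ_P(x) into Tr P^{1/2} U Q^{1/2} with U unitary, and
two-positivity of Λ gives a Cauchy–Schwarz bound (`IsQuantumChannel.leftPolar_le_trace`). No bound
on x enters here.

In (a), two-positivity makes Z = Λ(P^{1/2} Q^{1/2}) satisfy Z Λ(P)⁻¹ Z ≤ Λ(Q). Renaming Λ(P), Λ(Q)
as P, Q, monotonicity of the square root gives Tr Z ≤ Tr P K with K = (P^{-1/2} Q P^{-1/2})^{1/2},
the value of the path at x = -1. It remains to see that this value is least on [-1,1]: Tr P K ≤ Tr
P^{1-s} |K P^s| for s in [0,1] (`trace_mul_le_trace_rpow_mul_sqrt`). In an eigenbasis of P the two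
powers are similarly ordered diagonals, and a layer decomposition reduces the claim to partial
diagonal sums (`sum_superlevel_absMulDiag`). -/

namespace PolarFidelity

set_option linter.unusedSectionVars false

/-! ### Square roots, polar decomposition and the trace norm -/

section MatrixSqrt

open Matrix

variable {n : Type*} [Fintype n] [DecidableEq n]

lemma sqrt_le_sqrt_of_le {A B : Matrix n n ℂ} (h : A ≤ B) : CFC.sqrt A ≤ CFC.sqrt B := by
  open scoped Matrix.Norms.L2Operator in
  exact CFC.sqrt_le_sqrt A B h

lemma conjTranspose_eq_of_nonneg {A : Matrix n n ℂ} (h : 0 ≤ A) : Aᴴ = A :=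
  (nonneg_iff_posSemidef.mp h).isHermitian

lemma le_sqrt_of_mul_self_le {A B : Matrix n n ℂ} (hA : 0 ≤ A) (h : A * A ≤ B) :
    A ≤ CFC.sqrt B := by
  have := sqrt_le_sqrt_of_le h
  rwa [CFC.sqrt_mul_self A hA] at this

lemma conj_mono {A B : Matrix n n ℂ} (C : Matrix n n ℂ) (h : A ≤ B) :
    Cᴴ * A * C ≤ Cᴴ * B * C :=
  star_left_conjugate_le_conjugate h C

lemma conj_nonneg {A : Matrix n n ℂ} (C : Matrix n n ℂ) (h : 0 ≤ A) : 0 ≤ Cᴴ * A * C :=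
  star_left_conjugate_nonneg h C

/-- Compression by a Hermitian contraction increases under the square root. -/
lemma contraction_conj_le_sqrt {A C : Matrix n n ℂ} (hA : 0 ≤ A) (hC : Cᴴ = C)
    (hC1 : C * C ≤ 1) : C * A * C ≤ CFC.sqrt (C * (A * A) * C) := by
  have h0 : 0 ≤ C * A * C := by simpa [hC] using conj_nonneg C hA
  refine le_sqrt_of_mul_self_le h0 ?_
  have h1 := conj_mono (A * C) hC1
  rw [conjTranspose_mul, hC, conjTranspose_eq_of_nonneg hA] at h1
  simpa [mul_assoc] using h1

lemma re_trace_mono {A B : Matrix n n ℂ} (h : A ≤ B) : A.trace.re ≤ B.trace.re := by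
  have := (Complex.le_def.mp (le_iff.mp h).trace_nonneg).1
  simpa [trace_sub] using this

lemma re_diag_mono {A B : Matrix n n ℂ} (h : A ≤ B) (i : n) : (A i i).re ≤ (B i i).re := by
  have := (Complex.le_def.mp ((le_iff.mp h).diag_nonneg (i := i))).1
  simpa using this

lemma exists_polar {T : Matrix n n ℂ} (hT : IsUnit T) :
    ∃ U : Matrix n n ℂ, Uᴴ * U = 1 ∧ U * Uᴴ = 1 ∧ T = U * CFC.sqrt (Tᴴ * T) := by
  have h0 : 0 ≤ Tᴴ * T := (posSemidef_conjTranspose_mul_self T).nonneg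
  set B := CFC.sqrt (Tᴴ * T) with hB
  have hB0 : 0 ≤ B := CFC.sqrt_nonneg _
  have hBB : B * B = Tᴴ * T := CFC.sqrt_mul_sqrt_self _ h0
  have hu : IsUnit B := (CFC.isUnit_sqrt_iff _ h0).mpr (hT.star.mul hT)
  have hd : IsUnit B.det := (isUnit_iff_isUnit_det B).mp hu
  have hUU : (T * B⁻¹)ᴴ * (T * B⁻¹) = 1 := by
    rw [conjTranspose_mul, conjTranspose_nonsing_inv, conjTranspose_eq_of_nonneg hB0]
    calc B⁻¹ * Tᴴ * (T * B⁻¹) = B⁻¹ * (Tᴴ * T) * B⁻¹ := by simp only [mul_assoc]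
      _ = 1 := by
        rw [← hBB, ← mul_assoc, nonsing_inv_mul _ hd, one_mul, mul_nonsing_inv _ hd]
  exact ⟨T * B⁻¹, hUU, mul_eq_one_comm.mp hUU, by
    rw [mul_assoc, nonsing_inv_mul _ hd, mul_one]⟩

/-- The real part of the trace is dominated by the trace norm. -/
lemma re_trace_le_trace_sqrt {T : Matrix n n ℂ} (hT : IsUnit T) :
    T.trace.re ≤ (CFC.sqrt (Tᴴ * T)).trace.re := by
  obtain ⟨U, hU, -, hTU⟩ := exists_polar hT
  set B := CFC.sqrt (Tᴴ * T)
  have hB0 : 0 ≤ B := CFC.sqrt_nonneg _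
  -- The trace of (1 - U) B (1 - U)ᴴ ≥ 0 is 2 Tr B - 2 Re Tr U B.
  have h := re_trace_mono (conj_nonneg (1 - U)ᴴ hB0)
  have e : (1 - U) * B * (1 - U)ᴴ = B - U * B - (U * B)ᴴ + U * B * Uᴴ := by
    rw [conjTranspose_sub, conjTranspose_one, conjTranspose_mul, conjTranspose_eq_of_nonneg hB0]
    noncomm_ring
  have e2 : (U * B * Uᴴ).trace = B.trace := by
    rw [trace_mul_comm, ← mul_assoc, hU, one_mul]
  rw [conjTranspose_conjTranspose, e, trace_add, trace_sub, trace_sub, e2,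
    trace_conjTranspose] at h
  simp only [trace_zero, Complex.add_re, Complex.sub_re, Complex.zero_re, Complex.star_def,
    Complex.conj_re] at h
  rw [hTU]
  linarith

end MatrixSqrt

/-! ### Diagonal sums of |K s| against comonotone weights -/

section Comonotone

open Matrix

variable {n : Type*} [Fintype n] [DecidableEq n]

/-- Summation by layers: a nonnegative weight pairs nonnegatively with `y` if `y` has nonnegative
sums over the superlevel sets of the weight. -/
lemma sum_mul_nonneg_of_superlevel {ι : Type*} [Fintype ι] (y : ι → ℝ) (w : ι → ℝ)
    (hw : ∀ i, 0 ≤ w i) (h : ∀ u : ℝ, 0 ≤ u → 0 ≤ ∑ i with u < w i, y i) :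
    0 ≤ ∑ i, w i * y i := by
  induction hk : (Finset.univ.filter fun i => 0 < w i).card using Nat.strong_induction_on
    generalizing w with
  | _ k ih =>
  rcases (Finset.univ.filter fun i => 0 < w i).eq_empty_or_nonempty with he | hne
  · have : ∀ i, w i = 0 := fun i => le_antisymm
      (not_lt.mp fun hi => by
        have : i ∈ Finset.univ.filter fun i => 0 < w i := by simpa using hi
        simp [he] at this) (hw i)
    simp [this]
  · obtain ⟨j, hj, hmin⟩ := Finset.exists_min_image _ w hne
    simp only [Finset.mem_filter, Finset.mem_univ, true_and] at hj hmin
    -- Peel off the lowest layer: the least positive weight is subtracted on the support, so the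
    -- support shrinks and each superlevel set of `v` is one of `w`.
    let v : ι → ℝ := fun i => if 0 < w i then w i - w j else 0
    have hv : ∀ i, 0 ≤ v i := fun i => by
      by_cases hi : 0 < w i
      · simpa [v, hi] using hmin i hi
      · simp [v, hi]
    have hlt : ∀ u : ℝ, 0 ≤ u → ∀ i, u < v i ↔ u + w j < w i := fun u hu i => by
      by_cases hi : 0 < w i
      · simp only [v, hi, if_true]; exact lt_sub_iff_add_lt
      · simp only [v, hi, if_false]
        exact ⟨fun h => absurd h hu.not_gt, fun h => absurd (by linarith) hi⟩
    have hcard : (Finset.univ.filter fun i => 0 < v i).card < k := by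
      rw [← hk]
      refine Finset.card_lt_card ⟨fun i hi => ?_, fun hs => ?_⟩
      · simp only [Finset.mem_filter, Finset.mem_univ, true_and, hlt 0 le_rfl] at hi ⊢
        linarith
      · have := hs (Finset.mem_filter.mpr ⟨Finset.mem_univ j, hj⟩)
        simp [hlt 0 le_rfl] at this
    have hrec := ih _ hcard v hv (fun u hu => by
      simpa only [hlt u hu] using h (u + w j) (by linarith)) rfl
    have hsum : ∑ i, w i * y i = ∑ i, v i * y i + w j * ∑ i with 0 < w i, y i := by
      rw [Finset.sum_filter, Finset.mul_sum, ← Finset.sum_add_distrib]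
      refine Finset.sum_congr rfl fun i _ => ?_
      by_cases hi : 0 < w i
      · simp only [v, hi, if_true]; ring
      · simp [v, le_antisymm (not_lt.mp hi) (hw i)]
    rw [hsum]
    exact add_nonneg hrec (mul_nonneg hj.le (h 0 le_rfl))

/-- The real diagonal matrix with entries `s`. -/
noncomputable def realDiag (s : n → ℝ) : Matrix n n ℂ := diagonal fun i => (s i : ℂ)

lemma conjTranspose_realDiag (s : n → ℝ) : (realDiag s)ᴴ = realDiag s := by
  simp [realDiag, diagonal_conjTranspose, Pi.star_def]

lemma realDiag_mul (s t : n → ℝ) : realDiag s * realDiag t = realDiag fun i => s i * t i := by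
  simp [realDiag]

lemma isUnit_realDiag {s : n → ℝ} (hs : ∀ i, 0 < s i) : IsUnit (realDiag s) := by
  rw [isUnit_iff_isUnit_det, realDiag, det_diagonal, isUnit_iff_ne_zero]
  exact Finset.prod_ne_zero_iff.mpr fun i _ => by exact_mod_cast (hs i).ne'

lemma realDiag_mul_self_le_one {s : n → ℝ} (h0 : ∀ i, 0 ≤ s i) (h1 : ∀ i, s i ≤ 1) :
    realDiag s * realDiag s ≤ 1 := by
  rw [realDiag_mul, le_iff, ← diagonal_one, realDiag, diagonal_sub]
  refine PosSemidef.diagonal fun i => ?_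
  have : 0 ≤ 1 - s i * s i := by nlinarith [h0 i, h1 i]
  simpa using (by exact_mod_cast this : (0 : ℂ) ≤ ((1 - s i * s i : ℝ) : ℂ))

/-- The absolute value of `K * diag s` for Hermitian `K`. -/
noncomputable def absMulDiag (K : Matrix n n ℂ) (s : n → ℝ) : Matrix n n ℂ :=
  CFC.sqrt (realDiag s * (K * K) * realDiag s)

lemma absMulDiag_nonneg (K : Matrix n n ℂ) (s : n → ℝ) : 0 ≤ absMulDiag K s := CFC.sqrt_nonneg _

lemma absMulDiag_mul_self {K : Matrix n n ℂ} (hK : 0 ≤ K) (s : n → ℝ) :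
    absMulDiag K s * absMulDiag K s = realDiag s * (K * K) * realDiag s := by
  refine CFC.sqrt_mul_sqrt_self _ ?_
  have := (posSemidef_conjTranspose_mul_self (K * realDiag s)).nonneg
  rw [conjTranspose_mul, conjTranspose_realDiag, conjTranspose_eq_of_nonneg hK] at this
  simpa only [mul_assoc] using this

lemma absMulDiag_absMulDiag {K : Matrix n n ℂ} (hK : 0 ≤ K) (s t : n → ℝ) :
    absMulDiag (absMulDiag K s) t = absMulDiag K fun i => s i * t i := by
  conv_lhs => rw [absMulDiag, absMulDiag_mul_self hK]
  rw [absMulDiag, ← realDiag_mul]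
  have : realDiag t * realDiag s = realDiag s * realDiag t := by
    simp only [realDiag_mul, mul_comm]
  congr 1
  rw [← this]
  simp only [mul_assoc]
  rw [this]

lemma diag_conj_realDiag (A : Matrix n n ℂ) (s : n → ℝ) (i : n) :
    ((realDiag s * A * realDiag s) i i).re = s i * s i * (A i i).re := by
  simp only [realDiag, mul_diagonal, diagonal_mul, Complex.mul_re, Complex.mul_im,
    Complex.ofReal_re, Complex.ofReal_im]
  ring

lemma mul_diag_le_absMulDiag {K : Matrix n n ℂ} (hK : 0 ≤ K) {s : n → ℝ}
    (h0 : ∀ i, 0 ≤ s i) (h1 : ∀ i, s i ≤ 1) (i : n) :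
    s i * s i * (K i i).re ≤ ((absMulDiag K s) i i).re := by
  rw [← diag_conj_realDiag]
  exact re_diag_mono (contraction_conj_le_sqrt hK (conjTranspose_realDiag s)
    (realDiag_mul_self_le_one h0 h1)) i

lemma sum_mul_diag_le_trace_absMulDiag {K : Matrix n n ℂ} (hK : K.PosDef) {s : n → ℝ}
    (hs : ∀ i, 0 < s i) :
    ∑ i, s i * (K i i).re ≤ ∑ i, ((absMulDiag K s) i i).re := by
  have h := re_trace_le_trace_sqrt (hK.isUnit.mul (isUnit_realDiag hs))
  rw [conjTranspose_mul, conjTranspose_realDiag, hK.isHermitian.eq] at h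
  have e : realDiag s * K * (K * realDiag s) = realDiag s * (K * K) * realDiag s := by
    simp only [mul_assoc]
  rw [e] at h
  simp only [trace, diag_apply, Complex.re_sum] at h
  refine le_of_eq_of_le (Finset.sum_congr rfl fun i _ => ?_) h
  simp [realDiag, mul_diagonal, mul_comm]

/-- Compare |K s| with |K r| for r = max(s, t). The full trace bound holds for r; diagonal
contractions relate |K r| to |K s| on A and to t K off A, so the terms off A cancel. -/
lemma sum_superlevel_absMulDiag {K : Matrix n n ℂ} (hK : K.PosDef) {s : n → ℝ}
    (hs : ∀ i, 0 < s i) {t : ℝ} (ht : 0 < t) (A : Finset n) (hA : ∀ i ∈ A, t ≤ s i)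
    (hA' : ∀ i ∉ A, s i ≤ t) :
    ∑ i ∈ A, s i * (K i i).re ≤ ∑ i ∈ A, ((absMulDiag K s) i i).re := by
  have hK0 : 0 ≤ K := hK.posSemidef.nonneg
  set r : n → ℝ := fun i => max (s i) t with hr
  have hrt : ∀ i, t ≤ r i := fun i => le_max_right _ _
  have hr0 : ∀ i, 0 < r i := fun i => ht.trans_le (hrt i)
  have hB : absMulDiag (absMulDiag K r) (fun i => min (s i) t / t) = absMulDiag K s := by
    rw [absMulDiag_absMulDiag hK0]
    congr 1
    funext i
    rw [mul_div_assoc', max_mul_min, mul_div_cancel_right₀ _ ht.ne']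
  have hKr : absMulDiag (absMulDiag K r) (fun i => t / r i) = absMulDiag K fun _ => t := by
    rw [absMulDiag_absMulDiag hK0]
    congr 1
    funext i
    rw [mul_div_cancel₀ _ (hr0 i).ne']
  have hKt : absMulDiag K (fun _ => t) = (t : ℂ) • K := by
    refine CFC.sqrt_unique ?_ ?_
    · have : realDiag (fun _ : n => t) = (t : ℂ) • 1 := by
        rw [realDiag, smul_one_eq_diagonal]
      simp [this]
    · exact (hK.posSemidef.smul (by exact_mod_cast ht.le)).nonneg
  -- The contraction min(s, t) / t carries r to s and equals 1 on A.
  have h1 : ∀ i ∈ A, ((absMulDiag K r) i i).re ≤ ((absMulDiag K s) i i).re := fun i hi => by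
    have := mul_diag_le_absMulDiag (absMulDiag_nonneg K r) (s := fun i => min (s i) t / t)
      (fun i => div_nonneg (le_min (hs i).le ht.le) ht.le)
      (fun i => (div_le_one ht).mpr (min_le_right _ _)) i
    rw [hB] at this
    simpa [min_eq_right (hA i hi), ht.ne'] using this
  -- The contraction t / r carries r to the constant t and equals 1 off A.
  have h2 : ∀ i ∈ Aᶜ, ((absMulDiag K r) i i).re ≤ t * (K i i).re := fun i hi => by
    have := mul_diag_le_absMulDiag (absMulDiag_nonneg K r) (s := fun i => t / r i)
      (fun i => div_nonneg ht.le (hr0 i).le) (fun i => (div_le_one (hr0 i)).mpr (hrt i)) i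
    rw [hKr, hKt] at this
    simpa [hr, max_eq_right (hA' i (Finset.mem_compl.mp hi)), ht.ne'] using this
  have h3 := sum_mul_diag_le_trace_absMulDiag hK hr0
  rw [← Finset.sum_add_sum_compl A, ← Finset.sum_add_sum_compl A] at h3
  have h4 : ∑ i ∈ A, r i * (K i i).re = ∑ i ∈ A, s i * (K i i).re :=
    Finset.sum_congr rfl fun i hi => by rw [hr]; simp only [max_eq_left (hA i hi)]
  have h5 : ∑ i ∈ Aᶜ, r i * (K i i).re = ∑ i ∈ Aᶜ, t * (K i i).re :=
    Finset.sum_congr rfl fun i hi => by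
      rw [hr]; simp only [max_eq_right (hA' i (Finset.mem_compl.mp hi))]
  linarith [Finset.sum_le_sum h1, Finset.sum_le_sum h2]

/-- For comonotone positive diagonal `w` and `s`: `Tr w K s ≤ Tr w |K s|`. -/
lemma sum_comonotone_absMulDiag {K : Matrix n n ℂ} (hK : K.PosDef) {s w : n → ℝ}
    (hs : ∀ i, 0 < s i) (hw : ∀ i, 0 ≤ w i) (hmono : Monovary w s) :
    ∑ i, w i * (s i * (K i i).re) ≤ ∑ i, w i * ((absMulDiag K s) i i).re := by
  rw [← sub_nonneg, ← Finset.sum_sub_distrib]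
  simp only [← mul_sub]
  refine sum_mul_nonneg_of_superlevel _ w hw fun u _ => ?_
  rw [Finset.sum_sub_distrib, sub_nonneg]
  rcases (Finset.univ.filter fun i => u < w i).eq_empty_or_nonempty with he | hne
  · simp [he]
  · obtain ⟨j, hj, hmin⟩ := Finset.exists_min_image _ s hne
    -- The threshold is the minimum of `s` on the superlevel set of `w`; comonotonicity keeps `s`
    -- below it elsewhere.
    refine sum_superlevel_absMulDiag hK hs (hs j) _ hmin fun i hi => ?_
    simp only [Finset.mem_filter, Finset.mem_univ, true_and, not_lt] at hj hi
    exact hmono.symm (hi.trans_lt hj)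

end Comonotone

/-! ### Real powers and the trace inequality in an eigenbasis -/

section Powers

open Matrix

variable {d : ℕ} {P Q : Matrix (Fin d) (Fin d) ℂ}

lemma rpow_rpow_of_posDef (hP : P.PosDef) (y z : ℝ) : (P ^ y) ^ z = P ^ (y * z) := by
  have h0 : IsStrictlyPositive P := isStrictlyPositive_iff_posDef.mpr hP
  rcases eq_or_ne y 0 with rfl | hy
  · rw [CFC.rpow_zero P h0.nonneg, CFC.one_rpow, zero_mul, CFC.rpow_zero P h0.nonneg]
  · exact CFC.rpow_rpow P y z hy h0

lemma rpow_mul_rpow_of_posDef (hP : P.PosDef) (y z : ℝ) : P ^ y * P ^ z = P ^ (y + z) :=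
  (CFC.rpow_add hP.isUnit).symm

lemma rpow_zero_of_posDef (hP : P.PosDef) : P ^ (0 : ℝ) = 1 :=
  CFC.rpow_zero P hP.posSemidef.nonneg

lemma rpow_one_of_posDef (hP : P.PosDef) : P ^ (1 : ℝ) = P :=
  CFC.rpow_one P hP.posSemidef.nonneg

lemma posDef_rpow (hP : P.PosDef) (y : ℝ) : (P ^ y).PosDef :=
  isStrictlyPositive_iff_posDef.mp
    (IsStrictlyPositive.rpow P y (isStrictlyPositive_iff_posDef.mpr hP))

lemma conjTranspose_rpow (P : Matrix (Fin d) (Fin d) ℂ) (y : ℝ) : (P ^ y)ᴴ = P ^ y :=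
  conjTranspose_eq_of_nonneg CFC.rpow_nonneg

lemma inv_eq_rpow_neg_one (hP : P.PosDef) : P⁻¹ = P ^ (-1 : ℝ) := by
  refine inv_eq_left_inv ?_
  conv_lhs => rw [← rpow_one_of_posDef hP, rpow_rpow_of_posDef hP, one_mul,
    rpow_mul_rpow_of_posDef hP]
  rw [neg_add_cancel, rpow_zero_of_posDef hP]

lemma rpow_conj_rpow_conj (hP : P.PosDef) (A : Matrix (Fin d) (Fin d) ℂ) (y z : ℝ) :
    P ^ y * (P ^ z * A * P ^ z) * P ^ y = P ^ (y + z) * A * P ^ (y + z) := by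
  have h : P ^ z * P ^ y = P ^ (y + z) := by rw [rpow_mul_rpow_of_posDef hP, add_comm]
  calc P ^ y * (P ^ z * A * P ^ z) * P ^ y
      = P ^ y * P ^ z * A * (P ^ z * P ^ y) := by simp only [mul_assoc]
    _ = _ := by rw [h, rpow_mul_rpow_of_posDef hP]

lemma rpow_mul_trace (hP : P.PosDef) (A : Matrix (Fin d) (Fin d) ℂ) (y : ℝ) :
    (P ^ y * A * P ^ y).trace = (P ^ (2 * y) * A).trace := by
  rw [trace_mul_comm, ← mul_assoc, rpow_mul_rpow_of_posDef hP, two_mul]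

lemma rpow_conj_posDef (hP : P.PosDef) (hQ : Q.PosDef) (y : ℝ) : (P ^ y * Q * P ^ y).PosDef := by
  have h : (P ^ y * Q * P ^ y).PosSemidef := by
    simpa [conjTranspose_rpow] using hQ.posSemidef.conjTranspose_mul_mul_same (P ^ y)
  exact h.posDef_iff_isUnit.mpr
    (((posDef_rpow hP y).isUnit.mul hQ.isUnit).mul (posDef_rpow hP y).isUnit)

lemma posDef_sqrt (hP : P.PosDef) : (CFC.sqrt P).PosDef := by
  rw [CFC.sqrt_eq_rpow]
  exact posDef_rpow hP _

/-- Powers of a positive definite matrix in an eigenbasis. -/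
lemma rpow_eq_eigenbasis (hP : P.PosDef) (y : ℝ) :
    P ^ y = (hP.isHermitian.eigenvectorUnitary : Matrix (Fin d) (Fin d) ℂ) *
      realDiag (fun i => hP.isHermitian.eigenvalues i ^ y) *
      (hP.isHermitian.eigenvectorUnitary : Matrix (Fin d) (Fin d) ℂ)ᴴ := by
  rw [CFC.rpow_eq_cfc_real hP.posSemidef.nonneg, hP.isHermitian.cfc_eq, IsHermitian.cfc,
    Unitary.conjStarAlgAut_apply]
  rfl

lemma trace_mul_le_trace_rpow_mul_sqrt {K : Matrix (Fin d) (Fin d) ℂ} (hP : P.PosDef)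
    (hK : K.PosDef) {s : ℝ} (hs0 : 0 ≤ s) (hs1 : s ≤ 1) :
    (P * K).trace.re ≤ (P ^ (1 - s) * CFC.sqrt (P ^ s * (K * K) * P ^ s)).trace.re := by
  obtain ⟨U, hU⟩ : ∃ U : Matrix (Fin d) (Fin d) ℂ,
      U = (hP.isHermitian.eigenvectorUnitary : Matrix (Fin d) (Fin d) ℂ) := ⟨_, rfl⟩
  set p := hP.isHermitian.eigenvalues with hp
  have hp0 : ∀ i, 0 < p i := hP.eigenvalues_pos
  have hpow : ∀ y : ℝ, P ^ y = U * realDiag (fun i => p i ^ y) * Uᴴ := by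
    rw [hU]; exact rpow_eq_eigenbasis hP
  have hUU : Uᴴ * U = 1 := by
    rw [hU]; exact (Unitary.mem_iff.mp hP.isHermitian.eigenvectorUnitary.2).1
  have hUU' : U * Uᴴ = 1 := by
    rw [hU]; exact (Unitary.mem_iff.mp hP.isHermitian.eigenvectorUnitary.2).2
  have hcl : ∀ X : Matrix (Fin d) (Fin d) ℂ, Uᴴ * (U * X) = X := fun X => by
    rw [← mul_assoc, hUU, one_mul]
  have hcl' : ∀ X : Matrix (Fin d) (Fin d) ℂ, U * (Uᴴ * X) = X := fun X => by
    rw [← mul_assoc, hUU', one_mul]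
  have hL : (Uᴴ * K * U).PosDef := by
    refine (hK.posSemidef.conjTranspose_mul_mul_same U).posDef_iff_isUnit.mpr ?_
    exact ((IsUnit.of_mul_eq_one _ hUU).mul hK.isUnit).mul (IsUnit.of_mul_eq_one _ hUU')
  set L := Uᴴ * K * U with hLdef
  set σ : Fin d → ℝ := fun i => p i ^ s with hσ
  set w : Fin d → ℝ := fun i => p i ^ (1 - s) with hw
  have hsqrt : CFC.sqrt (P ^ s * (K * K) * P ^ s) = U * absMulDiag L σ * Uᴴ := by
    refine CFC.sqrt_unique ?_ ?_
    · calc U * absMulDiag L σ * Uᴴ * (U * absMulDiag L σ * Uᴴ)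
          = U * (absMulDiag L σ * absMulDiag L σ) * Uᴴ := by simp only [mul_assoc, hcl]
        _ = P ^ s * (K * K) * P ^ s := by
          rw [absMulDiag_mul_self hL.posSemidef.nonneg, hpow, hLdef]
          simp only [mul_assoc, hcl', hσ]
    · simpa using conj_nonneg Uᴴ (absMulDiag_nonneg L σ)
  have hr : (P ^ (1 - s) * CFC.sqrt (P ^ s * (K * K) * P ^ s)).trace.re =
      ∑ i, w i * ((absMulDiag L σ) i i).re := by
    have : P ^ (1 - s) * CFC.sqrt (P ^ s * (K * K) * P ^ s) =
        U * (realDiag w * absMulDiag L σ * Uᴴ) := by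
      rw [hsqrt, hpow]
      simp only [mul_assoc, hcl, hw]
    rw [this, trace_mul_comm, mul_assoc, hUU, mul_one]
    simp [trace, realDiag, diagonal_mul]
  have hl : (P * K).trace.re = ∑ i, w i * (σ i * (L i i).re) := by
    have : P * K = U * (realDiag (fun i => p i ^ (1 : ℝ)) * Uᴴ * K) := by
      conv_lhs => rw [← rpow_one_of_posDef hP, hpow]
      simp only [mul_assoc]
    rw [this, trace_mul_comm, mul_assoc, mul_assoc, ← mul_assoc Uᴴ, ← hLdef]
    simp only [trace, realDiag, diag_apply, diagonal_mul, Complex.re_sum, Complex.re_ofReal_mul]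
    refine Finset.sum_congr rfl fun i _ => ?_
    rw [← mul_assoc, hw, hσ, ← Real.rpow_add (hp0 i), sub_add_cancel]
  rw [hl, hr]
  refine sum_comonotone_absMulDiag hL (fun i => Real.rpow_pos_of_pos (hp0 i) _)
    (fun i => (Real.rpow_pos_of_pos (hp0 i) _).le) fun i j hij => ?_
  have hlt : p i < p j := lt_of_not_ge fun h =>
    hij.not_ge (Real.rpow_le_rpow (hp0 j).le h hs0)
  exact Real.rpow_le_rpow (hp0 i).le hlt.le (by linarith)

end Powers

/-! ### One-sided polar paths -/

section Polar

open Matrix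

variable {d : ℕ} {P Q : Matrix (Fin d) (Fin d) ℂ}

lemma rightPolar_eq_leftPolar (x : ℝ) (hQ : Q.PosDef) :
    rightPolar x P Q = leftPolar x Q P := by
  unfold rightPolar leftPolar generalizedFidelity
  rw [(base_pow x hQ).1, mul_assoc, (base_pow x hQ).2, trace_mul_comm]

lemma leftPolar_eq (x : ℝ) (hP : P.PosDef) :
    leftPolar x P Q =
      (P ^ ((1 - x) / 2) * CFC.sqrt (P ^ (x / 2) * Q * P ^ (x / 2))).trace := by
  unfold leftPolar generalizedFidelity
  rw [(base_pow x hP).1, CFC.sqrt_eq_rpow, rpow_rpow_of_posDef hP, mul_one_div]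

lemma polarFidelity_eq (x : ℝ) (hQ : Q.PosDef) :
    polarFidelity x P Q = ((leftPolar x P Q).re + (leftPolar x Q P).re) / 2 := by
  rw [polarFidelity, rightPolar_eq_leftPolar x hQ]
  simp

lemma rpow_commute (h : Commute P Q) (y z : ℝ) : Commute (P ^ y) (Q ^ z) := by
  rw [CFC.rpow_def, CFC.rpow_def]
  exact ((h.symm.cfc_nnreal _).symm.cfc_nnreal _)

lemma leftPolar_of_commute (x : ℝ) (hP : P.PosDef) (hQ : Q.PosDef) (h : Commute P Q) :
    leftPolar x P Q = (P ^ (1 / 2 : ℝ) * Q ^ (1 / 2 : ℝ)).trace := by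
  have hc := rpow_commute h (x / 2) (1 / 2)
  have hs : CFC.sqrt (P ^ (x / 2) * Q * P ^ (x / 2)) = P ^ (x / 2) * Q ^ (1 / 2 : ℝ) := by
    refine CFC.sqrt_unique ?_ (hc.mul_nonneg CFC.rpow_nonneg CFC.rpow_nonneg)
    conv_lhs => rw [hc.eq, mul_assoc, ← mul_assoc (P ^ (x / 2)), hc.eq]
    have hc' : Commute (P ^ (x / 2)) Q := by
      simpa only [rpow_one_of_posDef hQ] using rpow_commute h (x / 2) 1
    have hQQ : Q ^ (1 / 2 : ℝ) * Q ^ (1 / 2 : ℝ) = Q := by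
      rw [rpow_mul_rpow_of_posDef hQ, add_halves, rpow_one_of_posDef hQ]
    rw [mul_assoc, ← mul_assoc, hQQ, hc'.eq, mul_assoc]
  rw [leftPolar_eq x hP, hs, ← mul_assoc, rpow_mul_rpow_of_posDef hP]
  congr 4
  ring

lemma leftPolar_eq_trace_unitary (x : ℝ) (hP : P.PosDef) (hQ : Q.PosDef) :
    ∃ U : Matrix (Fin d) (Fin d) ℂ, Uᴴ * U = 1 ∧
      leftPolar x P Q = (P ^ (1 / 2 : ℝ) * (U * Q ^ (1 / 2 : ℝ))).trace := by
  obtain ⟨V, hV, hV', h⟩ := exists_polar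
    ((posDef_rpow hQ (1 / 2)).isUnit.mul (posDef_rpow hP (x / 2)).isUnit)
  refine ⟨Vᴴ, by rwa [conjTranspose_conjTranspose], ?_⟩
  have hTT : (Q ^ (1 / 2 : ℝ) * P ^ (x / 2))ᴴ * (Q ^ (1 / 2 : ℝ) * P ^ (x / 2)) =
      P ^ (x / 2) * Q * P ^ (x / 2) := by
    have hQQ : Q ^ (1 / 2 : ℝ) * Q ^ (1 / 2 : ℝ) = Q := by
      rw [rpow_mul_rpow_of_posDef hQ, add_halves, rpow_one_of_posDef hQ]
    rw [conjTranspose_mul, conjTranspose_rpow, conjTranspose_rpow, mul_assoc, ← mul_assoc _ _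
      (P ^ (x / 2)), hQQ, mul_assoc]
  rw [hTT] at h
  have hs : CFC.sqrt (P ^ (x / 2) * Q * P ^ (x / 2)) =
      Vᴴ * Q ^ (1 / 2 : ℝ) * P ^ (x / 2) := by
    rw [mul_assoc Vᴴ, h, ← mul_assoc, hV, one_mul]
  rw [leftPolar_eq x hP, hs, ← mul_assoc, trace_mul_comm, ← mul_assoc,
    rpow_mul_rpow_of_posDef hP]
  congr 4
  ring

/-- A positive `Z` with `Z P⁻¹ Z ≤ Q` has trace at most the polar fidelity, if `|x| ≤ 1`. -/
lemma trace_le_leftPolar {x : ℝ} (hx : x ∈ Set.Icc (-1 : ℝ) 1) (hP : P.PosDef) (hQ : Q.PosDef)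
    {Z : Matrix (Fin d) (Fin d) ℂ} (hZ : 0 ≤ Z) (h : Z * P⁻¹ * Z ≤ Q) :
    Z.trace.re ≤ (leftPolar x P Q).re := by
  set J := P ^ (-1 / 2 : ℝ) with hJ
  have hJH : Jᴴ = J := conjTranspose_rpow _ _
  have hJJ : J * J = P⁻¹ := by
    rw [hJ, rpow_mul_rpow_of_posDef hP, inv_eq_rpow_neg_one hP]
    norm_num
  set K := CFC.sqrt (J * Q * J) with hKdef
  have hJQ : (J * Q * J).PosDef := rpow_conj_posDef hP hQ _
  have hK : K.PosDef := posDef_sqrt hJQ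
  have hKK : K * K = J * Q * J := CFC.sqrt_mul_sqrt_self _ hJQ.posSemidef.nonneg
  have hY : J * Z * J ≤ K := by
    refine le_sqrt_of_mul_self_le (by simpa [hJH] using conj_nonneg J hZ) ?_
    have := conj_mono J h
    rw [hJH, ← hJJ] at this
    simpa only [mul_assoc] using this
  have h1 := re_trace_mono (conj_mono (P ^ (1 / 2 : ℝ)) hY)
  rw [conjTranspose_rpow, hJ, rpow_conj_rpow_conj hP, rpow_mul_trace hP _ (1 / 2)] at h1
  norm_num [rpow_zero_of_posDef hP, rpow_one_of_posDef hP] at h1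
  refine h1.trans ?_
  -- This s turns P^s P^{-1/2} into P^{x/2}, and s lies in [0,1] exactly when |x| ≤ 1.
  have h2 := trace_mul_le_trace_rpow_mul_sqrt hP hK (s := (1 + x) / 2)
    (by linarith [hx.1]) (by linarith [hx.2])
  rw [hKK, hJ, rpow_conj_rpow_conj hP] at h2
  rw [leftPolar_eq x hP]
  have e1 : 1 - (1 + x) / 2 = (1 - x) / 2 := by ring
  have e2 : (1 + x) / 2 + -1 / 2 = x / 2 := by ring
  rwa [e1, e2] at h2

end Polar

/-! ### Two-positivity and monotonicity under channels -/

section Channel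

open Matrix

variable {d e : ℕ} {Λ : Matrix (Fin d) (Fin d) ℂ →ₗ[ℂ] Matrix (Fin e) (Fin e) ℂ}

open scoped CStarAlgebra Matrix.Norms.L2Operator in
/-- Two-positivity of a channel, tested on the columns `X` and `Y`. -/
lemma IsQuantumChannel.two_positive (hΛ : IsQuantumChannel Λ) (a b : Matrix (Fin d) (Fin d) ℂ)
    (X Y : Matrix (Fin e) (Fin e) ℂ) :
    0 ≤ Xᴴ * Λ (aᴴ * a) * X + Xᴴ * Λ (aᴴ * b) * Y + Yᴴ * Λ (bᴴ * a) * X +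
      Yᴴ * Λ (bᴴ * b) * Y := by
  obtain ⟨⟨Φ, rfl⟩, -⟩ := hΛ
  let M : CStarMatrix (Fin 2) (Fin 2) (Matrix (Fin d) (Fin d) ℂ) :=
    CStarMatrix.ofMatrix !![a, b; 0, 0]
  -- Positive block matrices are generated by the squares cᴴ c, for which the form is visibly a sum
  -- of squares.
  have key : ∀ N : CStarMatrix (Fin 2) (Fin 2) (Matrix (Fin e) (Fin e) ℂ), 0 ≤ N →
      0 ≤ Xᴴ * N 0 0 * X + Xᴴ * N 0 1 * Y + Yᴴ * N 1 0 * X + Yᴴ * N 1 1 * Y := by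
    intro N hN
    rw [StarOrderedRing.nonneg_iff] at hN
    induction hN using AddSubmonoid.closure_induction with
    | mem N hN =>
      obtain ⟨c, rfl⟩ := hN
      refine le_of_le_of_eq (add_nonneg (star_mul_self_nonneg (c 0 0 * X + c 0 1 * Y))
        (star_mul_self_nonneg (c 1 0 * X + c 1 1 * Y))) ?_
      simp only [star_eq_conjTranspose, conjTranspose_add, conjTranspose_mul,
        CStarMatrix.mul_apply, CStarMatrix.star_apply, Fin.sum_univ_two]
      noncomm_ring
    | zero => simp
    | add N N' _ _ h h' =>
      refine le_of_le_of_eq (add_nonneg h h') ?_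
      simp only [CStarMatrix.add_apply]
      noncomm_ring
  have h := key _ (Φ.map_cstarMatrix_nonneg' 2 (star M * M) (star_mul_self_nonneg M))
  simpa [M, CStarMatrix.mul_apply, CStarMatrix.star_apply, CStarMatrix.map_apply,
    star_eq_conjTranspose] using h

lemma IsQuantumChannel.nonneg (hΛ : IsQuantumChannel Λ) {A : Matrix (Fin d) (Fin d) ℂ}
    (hA : 0 ≤ A) : 0 ≤ Λ A := by
  obtain ⟨c, rfl⟩ := CStarAlgebra.nonneg_iff_eq_star_mul_self.mp hA
  simpa [star_eq_conjTranspose] using hΛ.two_positive c 0 1 0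

variable {P Q : Matrix (Fin d) (Fin d) ℂ} {x : ℝ}

lemma rpow_half_mul_self (hP : P.PosDef) : P ^ (1 / 2 : ℝ) * P ^ (1 / 2 : ℝ) = P := by
  rw [rpow_mul_rpow_of_posDef hP, add_halves, rpow_one_of_posDef hP]

lemma IsQuantumChannel.trace_le_leftPolar (hΛ : IsQuantumChannel Λ)
    (hx : x ∈ Set.Icc (-1 : ℝ) 1) (hP : P.PosDef) (hQ : Q.PosDef)
    (hΛP : (Λ P).PosDef) (hΛQ : (Λ Q).PosDef) (h : Commute P Q) :
    (P ^ (1 / 2 : ℝ) * Q ^ (1 / 2 : ℝ)).trace.re ≤ (leftPolar x (Λ P) (Λ Q)).re := by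
  have hc := rpow_commute h (1 / 2) (1 / 2)
  have hZ := hΛ.nonneg (hc.mul_nonneg CFC.rpow_nonneg CFC.rpow_nonneg)
  rw [← hΛ.2]
  refine PolarFidelity.trace_le_leftPolar hx hΛP hΛQ hZ ?_
  -- Testing on the column (-Λ(P)⁻¹ Z, 1) extracts the Schur complement Λ(Q) - Z Λ(P)⁻¹ Z.
  have h2 := hΛ.two_positive (P ^ (1 / 2 : ℝ)) (Q ^ (1 / 2 : ℝ))
    (-((Λ P)⁻¹ * Λ (P ^ (1 / 2 : ℝ) * Q ^ (1 / 2 : ℝ)))) 1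
  simp only [conjTranspose_rpow, rpow_half_mul_self hP, rpow_half_mul_self hQ, ← hc.eq] at h2
  set Z := Λ (P ^ (1 / 2 : ℝ) * Q ^ (1 / 2 : ℝ))
  have hd : IsUnit (Λ P).det := (isUnit_iff_isUnit_det _).mp hΛP.isUnit
  rw [conjTranspose_neg, conjTranspose_mul, conjTranspose_eq_of_nonneg hZ,
    hΛP.inv.isHermitian.eq, conjTranspose_one] at h2
  rw [← sub_nonneg]
  refine le_of_le_of_eq h2 ?_
  have e : Z * (Λ P)⁻¹ * Λ P = Z := by rw [mul_assoc, nonsing_inv_mul _ hd, mul_one]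
  simp only [neg_mul, mul_neg, e, mul_one, one_mul, neg_neg, ← mul_assoc]
  abel

/-- Weighted Cauchy–Schwarz: X and Y are mutually inverse, so trace preservation turns the cross
terms into -2 Re Φ_P(x). The quarter powers make X² Λ(P) and Y² Λ(Q) both equal to Λ(P)^{1/2}
Λ(Q)^{1/2}. -/
lemma IsQuantumChannel.leftPolar_le_trace (hΛ : IsQuantumChannel Λ)
    (hP : P.PosDef) (hQ : Q.PosDef)
    (hΛP : (Λ P).PosDef) (hΛQ : (Λ Q).PosDef) (h : Commute (Λ P) (Λ Q)) :
    (leftPolar x P Q).re ≤ (Λ P ^ (1 / 2 : ℝ) * Λ Q ^ (1 / 2 : ℝ)).trace.re := by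
  obtain ⟨U, hU, hPQ⟩ := leftPolar_eq_trace_unitary x hP hQ
  set X := Λ P ^ (-1 / 4 : ℝ) * Λ Q ^ (1 / 4 : ℝ) with hX
  set Y := Λ P ^ (1 / 4 : ℝ) * Λ Q ^ (-1 / 4 : ℝ) with hY
  have hXH : Xᴴ = X := by
    rw [hX, conjTranspose_mul, conjTranspose_rpow, conjTranspose_rpow, (rpow_commute h _ _).eq]
  have hYH : Yᴴ = Y := by
    rw [hY, conjTranspose_mul, conjTranspose_rpow, conjTranspose_rpow, (rpow_commute h _ _).eq]
  have hmul : ∀ y z y' z' : ℝ, Λ P ^ y * Λ Q ^ z * (Λ P ^ y' * Λ Q ^ z') =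
      Λ P ^ (y + y') * Λ Q ^ (z + z') := fun y z y' z' => by
    rw [← rpow_mul_rpow_of_posDef hΛP, ← rpow_mul_rpow_of_posDef hΛQ, mul_assoc,
      ← mul_assoc (Λ Q ^ z), ← (rpow_commute h y' z).eq]
    simp only [mul_assoc]
  have hYX : Y * X = 1 := by
    rw [hX, hY, hmul]
    norm_num [rpow_zero_of_posDef hΛP, rpow_zero_of_posDef hΛQ]
  have hXY : X * Y = 1 := mul_eq_one_comm.mp hYX
  have hXX : X * X * Λ P = Λ P ^ (1 / 2 : ℝ) * Λ Q ^ (1 / 2 : ℝ) := by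
    have e : Λ P = Λ P ^ (1 : ℝ) * Λ Q ^ (0 : ℝ) := by
      rw [rpow_zero_of_posDef hΛQ, rpow_one_of_posDef hΛP, mul_one]
    calc X * X * Λ P = X * X * (Λ P ^ (1 : ℝ) * Λ Q ^ (0 : ℝ)) := by rw [← e]
      _ = _ := by rw [hX, hmul, hmul]; norm_num
  have hYY : Y * Y * Λ Q = Λ P ^ (1 / 2 : ℝ) * Λ Q ^ (1 / 2 : ℝ) := by
    have e : Λ Q = Λ P ^ (0 : ℝ) * Λ Q ^ (1 : ℝ) := by
      rw [rpow_zero_of_posDef hΛP, rpow_one_of_posDef hΛQ, one_mul]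
    calc Y * Y * Λ Q = Y * Y * (Λ P ^ (0 : ℝ) * Λ Q ^ (1 : ℝ)) := by rw [← e]
      _ = _ := by rw [hY, hmul, hmul]; norm_num
  have hcyc : ∀ A B C : Matrix (Fin e) (Fin e) ℂ, (A * B * C).trace = (C * A * B).trace :=
    fun A B C => by rw [trace_mul_comm, mul_assoc]
  set a := P ^ (1 / 2 : ℝ)
  set b := U * Q ^ (1 / 2 : ℝ) with hb
  have haa : aᴴ * a = P := by rw [conjTranspose_rpow, rpow_half_mul_self hP]
  have hbb : bᴴ * b = Q := by
    rw [hb, conjTranspose_mul, mul_assoc, ← mul_assoc Uᴴ, hU, one_mul, conjTranspose_rpow,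
      rpow_half_mul_self hQ]
  have h2 := re_trace_mono (hΛ.two_positive a b X (-Y))
  rw [haa, hbb, conjTranspose_neg, hXH, hYH] at h2
  simp only [mul_neg, neg_mul, neg_neg, trace_add, trace_neg] at h2
  rw [hcyc X _ X, hcyc X _ Y, hcyc Y _ X, hcyc Y _ Y, hXX, hYY, hYX, hXY, one_mul, one_mul,
    hΛ.2, hΛ.2] at h2
  have hba : (bᴴ * a).trace = star (aᴴ * b).trace := by
    rw [← trace_conjTranspose, conjTranspose_mul aᴴ b, conjTranspose_conjTranspose a]
  rw [hba, conjTranspose_rpow, ← hPQ] at h2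
  simp only [trace_zero, Complex.zero_re, Complex.add_re, Complex.neg_re, Complex.star_def,
    Complex.conj_re] at h2
  linarith

lemma IsQuantumChannel.polarFidelity_mono_of_commute (hΛ : IsQuantumChannel Λ)
    (hx : x ∈ Set.Icc (-1 : ℝ) 1) (hP : P.PosDef) (hQ : Q.PosDef)
    (hΛP : (Λ P).PosDef) (hΛQ : (Λ Q).PosDef) (h : Commute P Q) :
    polarFidelity x P Q ≤ polarFidelity x (Λ P) (Λ Q) := by
  rw [polarFidelity_eq x hQ, polarFidelity_eq x hΛQ, leftPolar_of_commute x hP hQ h,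
    leftPolar_of_commute x hQ hP h.symm]
  linarith [hΛ.trace_le_leftPolar hx hP hQ hΛP hΛQ h,
    hΛ.trace_le_leftPolar hx hQ hP hΛQ hΛP h.symm]

lemma IsQuantumChannel.polarFidelity_mono_of_commute_image (hΛ : IsQuantumChannel Λ)
    (hP : P.PosDef) (hQ : Q.PosDef)
    (hΛP : (Λ P).PosDef) (hΛQ : (Λ Q).PosDef) (h : Commute (Λ P) (Λ Q)) :
    polarFidelity x P Q ≤ polarFidelity x (Λ P) (Λ Q) := by
  rw [polarFidelity_eq x hQ, polarFidelity_eq x hΛQ, leftPolar_of_commute x hΛP hΛQ h,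
    leftPolar_of_commute x hΛQ hΛP h.symm]
  linarith [hΛ.leftPolar_le_trace (x := x) hP hQ hΛP hΛQ h,
    hΛ.leftPolar_le_trace (x := x) hQ hP hΛQ hΛP h.symm]

end Channel

end PolarFidelity

theorem mainTheorem11 {d e : ℕ} (x : ℝ) (hx : x ∈ Set.Icc (-1 : ℝ) 1)
    (P Q : Matrix (Fin d) (Fin d) ℂ) (hP : P.PosDef) (hQ : Q.PosDef)
    (Λ : Matrix (Fin d) (Fin d) ℂ →ₗ[ℂ] Matrix (Fin e) (Fin e) ℂ)
    (hΛ : PolarFidelity.IsQuantumChannel Λ)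
    (hΛP : (Λ P).PosDef) (hΛQ : (Λ Q).PosDef)
    (h : Commute P Q ∨ Commute (Λ P) (Λ Q) ∨
      ∃ (k : ℕ) (M : Matrix (Fin d) (Fin d) ℂ →ₗ[ℂ] Matrix (Fin k) (Fin k) ℂ)
        (Γ : Matrix (Fin k) (Fin k) ℂ →ₗ[ℂ] Matrix (Fin e) (Fin e) ℂ),
        PolarFidelity.IsQuantumChannel M ∧ PolarFidelity.HasCommutingRange M ∧
        PolarFidelity.IsQuantumChannel Γ ∧ Λ = Γ ∘ₗ M ∧ (M P).PosDef ∧ (M Q).PosDef) :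
    PolarFidelity.polarFidelity x P Q ≤ PolarFidelity.polarFidelity x (Λ P) (Λ Q) := by
  rcases h with h | h | ⟨k, M, Γ, hM, hcomm, hΓ, rfl, hMP, hMQ⟩
  · exact hΛ.polarFidelity_mono_of_commute hx hP hQ hΛP hΛQ h
  · exact hΛ.polarFidelity_mono_of_commute_image hP hQ hΛP hΛQ h
  · exact (hM.polarFidelity_mono_of_commute_image hP hQ hMP hMQ (hcomm P Q)).trans
      (hΓ.polarFidelity_mono_of_commute hx hMP hMQ hΛP hΛQ (hcomm P Q))
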